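/- Let $\mathbb D=\{z\in\mathbb C:|z|<1\}$ and let $\mathcal S$ be the class of functions $f$ analytic and univalent in $\mathbb D$ with $f(0)=0$, $f'(0)=1$. For $f,g$ analytic in $\mathbb D$ write $f\prec g$ if $f=g\circ\omega$ on $\mathbb D$ for some analytic $\omega:\mathbb D\to\mathbb D$ with $\omega(0)=0$. For $-1<\alpha\le\beta<1$ put $$\mathcal T_0(\alpha,\beta)=\begin{cases}1-\dfrac{(1-\alpha\beta)\left[2\sqrt{\alpha\beta(1-\alpha^2)(1-\beta^2)}+(\alpha+\beta)(1-\alpha\beta)\right]}{(1+\alpha\beta)^2}& \text{if } 0<\alpha<1 \text{ and } \beta_1(\alpha)<\beta<1,\\[2mm] 1-\dfrac{(1+\alpha)(1+\beta)}2&\text{otherwise,}\end{cases}$$ where $\beta_1(\alpha)=\dfrac{(1+\alpha)\sqrt{\alpha^2+14\alpha+1}-(\alpha^2+6\alpha+1)}{2\alpha(1-\alpha)}$. For $0\le\gamma<1$ with $\gamma\ge\mathcal T_0(\alpha,\beta)$ let $\mathcal{ST}_{snail}(\alpha,\beta,\gamma)$ be the class of all $f\in\mathcal S$ such that $$\frac{zf'(z)}{f(z)}\prec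 \mathcal T_{\alpha,\beta,\gamma}(z)=1+\frac{(2-2\gamma)z}{(1-\alpha z)(1-\beta z)} .$$ The quotients $zf'(z)/f(z)$ and $f(z)/z$ are understood to have the value $1$ at $z=0$. **Theorem.** Let $-1<\alpha<\beta<1$, $0\le\gamma<1$, $\gamma\ge\mathcal T_0(\alpha,\beta)$, and let $f\in\mathcal{ST}_{snail}(\alpha,\beta,\gamma)$. Then $f(z)/z\notin(-\infty,0]$ for all $z\in\mathbb D$, so that the principal argument $\operatorname{Arg}(f(z)/z)$ and the principal real powers of $f(z)/z$ are continuous in $\mathbb D$, and for all $z\in\mathbb D$: (i) $\displaystyle \operatorname{Re}\frac{f(z)}z>\left(\frac{1+\alpha}{1+\beta}\right)^{\frac{2-2\gamma}{\beta-\alpha}}$, provided that $\mathcal T_0(\alpha,\beta)\le 1-\frac{\beta-\alpha}2\le\gamma$; (ii) $\displaystyle \operatorname{Re}\left[\left(\frac{f(z)}z\right)^{\frac{\beta-\alpha}{2-2\gamma}}\right]>\frac{1+\alpha}{1+\beta}$; (iii) $\displaystyle \left|\operatorname{Arg}\frac{f(z)}z\right|\le\frac{2(1-\gamma)}{\beta-\alpha}\,\arcsin\left(\frac{|z|(\beta-\alpha)}{1-|z|^2\alpha\beta}\right)$.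 -/

import Mathlib

noncomputable section

namespace PascalSnail

/-- The open unit disc. -/
def disc : Set ℂ := Metric.ball 0 1

/-- The class `𝒮`: functions analytic and univalent in the unit disc, normalised by
`f(z) = z + a₂ z² + ⋯`. -/
def classS : Set (ℂ → ℂ) :=
  {f | DifferentiableOn ℂ f disc ∧ Set.InjOn f disc ∧ f 0 = 0 ∧ deriv f 0 = 1}

/-- `f ≺ g`: both are analytic in the disc, and `f = g ∘ ω` there for some analytic self-map `ω`
of the disc with `ω 0 = 0`. -/
def Subordinate (f g : ℂ → ℂ) : Prop :=
  DifferentiableOn ℂ f disc ∧ DifferentiableOn ℂ g disc ∧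
    ∃ ω : ℂ → ℂ, DifferentiableOn ℂ ω disc ∧ Set.MapsTo ω disc disc ∧ ω 0 = 0 ∧
      ∀ z ∈ disc, f z = g (ω z)

/-- `𝔏_{α,β,γ}(z) = (2 - 2γ) z / ((1 - αz)(1 - βz))`. -/
def snailL (α β γ : ℝ) (z : ℂ) : ℂ :=
  (2 - 2 * (γ : ℂ)) * z / ((1 - (α : ℂ) * z) * (1 - (β : ℂ) * z))

/-- `𝒯_{α,β,γ} = 1 + 𝔏_{α,β,γ}`. -/
def snailT (α β γ : ℝ) (z : ℂ) : ℂ := 1 + snailL α β γ z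

/-- The threshold `β₁(α)`. -/
def beta1 (α : ℝ) : ℝ :=
  ((1 + α) * Real.sqrt (α ^ 2 + 14 * α + 1) - (α ^ 2 + 6 * α + 1)) / (2 * α * (1 - α))

/-- The parameter region `B₁`. -/
def regionB1 : Set (ℝ × ℝ) :=
  {p | 0 < p.1 ∧ p.1 < 1 ∧ beta1 p.1 < p.2 ∧ p.2 < 1}

open Classical in
/-- The lower bound `𝒯₀(α,β)` for the parameter `γ`. -/
def snailT0 (α β : ℝ) : ℝ :=
  if (α, β) ∈ regionB1 then
    1 - (1 - α * β) * (2 * Real.sqrt (α * β * (1 - α ^ 2) * (1 - β ^ 2))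
        + (α + β) * (1 - α * β)) / (1 + α * β) ^ 2
  else 1 - (1 + α) * (1 + β) / 2

/-- `z f'(z) / f(z)` for `f ∈ 𝒮`, with its removable singularity at `0` filled in. -/
def logDerivZ (f : ℂ → ℂ) (z : ℂ) : ℂ := if z = 0 then 1 else z * deriv f z / f z

/-- `f(z) / z` for `f ∈ 𝒮`, with its removable singularity at `0` filled in. -/
def divZ (f : ℂ → ℂ) (z : ℂ) : ℂ := if z = 0 then 1 else f z / z

/-- The class `𝒮𝒯_snail(α,β,γ)`, considered for `-1 < α ≤ β < 1`, `0 ≤ γ < 1`, `𝒯₀(α,β) ≤ γ`. -/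
def STsnail (α β γ : ℝ) : Set (ℂ → ℂ) :=
  {f | f ∈ classS ∧ Subordinate (logDerivZ f) (snailT α β γ)}

end PascalSnail

end

/-!
Put `F(z) = f(z)/z`, which is holomorphic and zero-free in the disc, so `F = exp g` with
`g(0) = 0`. With `k = (2 - 2γ)/(β - α)` and `w = exp (g/k)`, the hypothesis `z f'/f = 𝒯(ω)`
becomes `z w'/w = (β - α) ω / ((1 - αω)(1 - βω))`, the equation solved by
`q(z) = (1 - αz)/(1 - βz)` when `ω(z) = z`.

The heart of the argument is that `w` is subordinate to `q`. Let `v = q⁻¹ ∘ w = (w - 1)/(βw - α)`.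
At a point `z₀` of least modulus with `‖v(z₀)‖ = 1`, Jack's lemma (`jack_lemma`) gives
`z₀ v'(z₀) = m v(z₀)` with `m ≥ 1`, and the differential equation turns this into
`m L(v(z₀)) = L(ω(z₀))` for the starlike function `L(z) = z/((1 - αz)(1 - βz))`, which is
impossible (`joukowski_ellipse_ne`). Hence `‖v‖ < 1` (`norm_sub_one_lt_of_logDeriv_eq`), and
`‖v(z)‖ ≤ ‖z‖` by the Schwarz lemma (`norm_sub_one_le_of_lt`).

So `w(z)` lies in the image under `q` of the closed disc of radius `‖z‖`, a disc in the right
half-plane: this bounds its real part (`lt_re_of_norm_sub_one_lt`) and its argument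
(`abs_arg_le_arcsin`), and shows that `g/k` is the principal logarithm of `w`. The assumption on
`γ` gives `1 - γ ≤ 1 - αβ` (`two_sub_le_of_snailT0_le`), whence `|Im g| < π` (`mul_arcsin_lt_pi`).
Thus `F` avoids the negative real axis, `g` is the principal logarithm of `F`, and `F = w ^ k` and
`w = F ^ (1/k)` hold with principal powers. The bound for `Re (F ^ (1/k))` and the one for the
argument follow at once; the bound for `Re F`, where `k ≤ 1`, follows from
`Re (w ^ k) ≥ (Re w) ^ k` (`re_rpow_le_re_exp_mul_log`).
-/

namespace PascalSnail

open Filter Topology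

/-! ### Jack's lemma and starlikeness -/

/-- **Jack's lemma**: if `v 0 = 0` and `‖v‖` attains the value `1` for the first time at `z₀`,
then `z₀ v'(z₀) / v(z₀)` is real and at least `1`. Differentiability is only needed in the open
ball and at `z₀` itself. -/
theorem jack_lemma {v : ℂ → ℂ} {z₀ v' : ℂ} (hz₀ : z₀ ≠ 0)
    (hd : DifferentiableOn ℂ v (Metric.ball 0 ‖z₀‖)) (hv0 : v 0 = 0)
    (hmaps : ∀ z ∈ Metric.ball (0 : ℂ) ‖z₀‖, ‖v z‖ ≤ 1)
    (hv' : HasDerivAt v v' z₀) (hnorm : ‖v z₀‖ = 1) :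
    ∃ m : ℝ, 1 ≤ m ∧ z₀ * v' = m * v z₀ := by
  have hR : 0 < ‖z₀‖ := norm_pos_iff.mpr hz₀
  have hschwarz : ∀ z ∈ Metric.ball (0 : ℂ) ‖z₀‖, ‖v z‖ ≤ ‖z‖ / ‖z₀‖ := by
    intro z hz
    have h := Complex.dist_le_div_mul_dist_of_mapsTo_ball (R₂ := 1) hd
      (fun y hy => by simpa [hv0] using hmaps y hy) hz
    simpa [hv0, div_eq_inv_mul] using h
  set M : ℂ := z₀ * v' * (starRingEnd ℂ) (v z₀) with hM
  -- `‖z‖² / ‖z₀‖² - ‖v z‖²` is nonnegative in the ball and vanishes at `z₀`, so its derivative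
  -- in every inward direction `ξ z₀` is nonnegative.
  have key : ∀ ξ : ℂ, ξ.re < 0 → 0 ≤ 2 * ξ.re - 2 * (ξ * M).re := by
    intro ξ hξ
    have hγ : HasDerivAt (fun t : ℝ => z₀ * (1 + (t : ℂ) * ξ)) (z₀ * ξ) 0 := by
      have h1 : HasDerivAt (fun t : ℝ => (t : ℂ)) 1 0 := Complex.ofRealCLM.hasDerivAt
      simpa using ((h1.mul_const ξ).const_add 1).const_mul z₀
    have hvγ : HasDerivAt (fun t : ℝ => v (z₀ * (1 + (t : ℂ) * ξ))) (v' * (z₀ * ξ)) 0 := by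
      have h2 : HasDerivAt v v' (z₀ * (1 + ((0 : ℝ) : ℂ) * ξ)) := by simpa using hv'
      exact h2.comp (0 : ℝ) hγ
    have hone : HasDerivAt (fun t : ℝ => 1 + 2 * t * ξ.re + t ^ 2 * ‖ξ‖ ^ 2) (2 * ξ.re) 0 := by
      have h3 : HasDerivAt (fun t : ℝ => t) 1 0 := hasDerivAt_id 0
      refine ((((h3.const_mul 2).mul_const ξ.re).const_add 1).add
        ((h3.pow 2).mul_const (‖ξ‖ ^ 2))).congr_deriv ?_
      simp
    have hsq : ∀ t : ℝ, ‖1 + (t : ℂ) * ξ‖ ^ 2 = 1 + 2 * t * ξ.re + t ^ 2 * ‖ξ‖ ^ 2 := by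
      intro t
      simp only [← Complex.normSq_eq_norm_sq, Complex.normSq_apply]
      simp
      ring
    have hh := hone.sub hvγ.norm_sq
    have hval : 2 * inner ℝ (v (z₀ * (1 + ((0 : ℝ) : ℂ) * ξ))) (v' * (z₀ * ξ))
        = 2 * (ξ * M).re := by
      rw [Complex.inner, hM]
      simp only [Complex.ofReal_zero, zero_mul, add_zero, mul_one]
      congr 2
      ring
    rw [hval] at hh
    have hslope := (hasDerivAt_iff_tendsto_slope.mp hh).mono_left
      (nhdsWithin_mono (0 : ℝ) (s := Set.Ioi 0) fun t ht => ne_of_gt ht)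
    refine ge_of_tendsto hslope ?_
    have hlim : Tendsto (fun t : ℝ => 2 * ξ.re + t * ‖ξ‖ ^ 2) (𝓝[>] 0) (𝓝 (2 * ξ.re)) := by
      have : Continuous fun t : ℝ => 2 * ξ.re + t * ‖ξ‖ ^ 2 := by fun_prop
      simpa using (this.tendsto 0).mono_left nhdsWithin_le_nhds
    filter_upwards [self_mem_nhdsWithin, hlim.eventually (gt_mem_nhds (by linarith : 2 * ξ.re < 0))]
      with t ht hneg
    have ht' : (0 : ℝ) < t := ht
    have hlt : ‖1 + (t : ℂ) * ξ‖ ^ 2 < 1 := by rw [hsq]; nlinarith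
    have hlt1 : ‖1 + (t : ℂ) * ξ‖ < 1 := by nlinarith [norm_nonneg (1 + (t : ℂ) * ξ)]
    have hmem : z₀ * (1 + (t : ℂ) * ξ) ∈ Metric.ball (0 : ℂ) ‖z₀‖ := by
      rw [mem_ball_zero_iff, norm_mul]
      nlinarith
    have hle := hschwarz _ hmem
    rw [norm_mul, mul_div_cancel_left₀ _ hR.ne'] at hle
    have hle2 : ‖v (z₀ * (1 + (t : ℂ) * ξ))‖ ^ 2 ≤ ‖1 + (t : ℂ) * ξ‖ ^ 2 := by gcongr
    rw [hsq] at hle2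
    rw [slope_def_field]
    refine div_nonneg ?_ (by linarith)
    simp [hnorm]
    linarith
  -- the directions `-1 ± i t` with `t` large leave no room for a nonzero imaginary part
  have him : M.im = 0 := by
    by_contra hne
    have h := key ⟨-1, (|M.re| + 2) / M.im⟩ (by norm_num)
    simp only [Complex.mul_re] at h
    rw [div_mul_cancel₀ _ hne] at h
    have h' := key ⟨-1, -((|M.re| + 2) / M.im)⟩ (by norm_num)
    simp only [Complex.mul_re] at h'
    rw [neg_mul (_ / _), div_mul_cancel₀ _ hne] at h'
    cases abs_cases M.re <;> linarith
  have hre : 1 ≤ M.re := by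
    have h := key (-1) (by norm_num)
    simp at h
    linarith
  refine ⟨M.re, hre, ?_⟩
  have hMre : ((M.re : ℝ) : ℂ) = M := Complex.ext (by simp) (by simp [him])
  have hconj : (starRingEnd ℂ) (v z₀) * v z₀ = 1 := by
    rw [Complex.conj_mul', hnorm]; simp
  rw [hMre, hM, mul_assoc, hconj, mul_one]

/-- Starlikeness of `L(z) = z / ((1 - αz)(1 - βz))` up to the unit circle, in the form that
`m L(u) = L(ω)` is impossible for `‖u‖ = 1`, `‖ω‖ < 1` and `m ≥ 1`. With `p = αβ` and
`J(z) = 1/z + pz` the equation reads `m J(ω) = (m - 1)(α + β) + J(u)`. The point `J(u)` lies on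
the ellipse with semi-axes `1 + p` and `1 - p`, the point `α + β` lies inside it, and `J(ω)` lies
outside it, so that `J(ω)` cannot be a convex combination of the other two. -/
theorem joukowski_ellipse_ne {α β m : ℝ} {u ω : ℂ} (hα : |α| < 1) (hβ : |β| < 1) (hm : 1 ≤ m)
    (hu : ‖u‖ = 1) (hω : ‖ω‖ < 1) :
    (m : ℂ) * u * ((1 - α * ω) * (1 - β * ω)) ≠ ω * ((1 - α * u) * (1 - β * u)) := by
  intro h
  obtain ⟨hα1, hα2⟩ := abs_lt.mp hα
  obtain ⟨hβ1, hβ2⟩ := abs_lt.mp hβ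
  have hu0 : u ≠ 0 := norm_ne_zero_iff.mp (by rw [hu]; norm_num)
  have hω0 : ω ≠ 0 := by
    rintro rfl
    have hm0 : m ≠ 0 := by linarith
    simp [hu0, hm0] at h
  have hJ : (m : ℂ) * (ω⁻¹ + (α * β : ℝ) * ω)
      = (m - 1 : ℝ) * (α + β : ℝ) + u⁻¹ + (α * β : ℝ) * u := by
    push_cast
    field_simp
    linear_combination h
  have huu : u.re * u.re + u.im * u.im = 1 := by
    rw [← Complex.normSq_apply, Complex.normSq_eq_norm_sq, hu]; norm_num
  have hinv : u⁻¹ = (starRingEnd ℂ) u := Complex.inv_eq_conj hu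
  rw [hinv] at hJ
  set N := Complex.normSq ω with hN
  have hN0 : 0 < N := Complex.normSq_pos.mpr hω0
  have hN1 : N < 1 := by
    rw [hN, Complex.normSq_eq_norm_sq]; nlinarith [norm_nonneg ω]
  have hNxy : ω.re * ω.re + ω.im * ω.im = N := (Complex.normSq_apply ω).symm
  have hre := congrArg Complex.re hJ
  have him := congrArg Complex.im hJ
  simp only [Complex.mul_re, Complex.mul_im, Complex.add_re, Complex.add_im, Complex.ofReal_re,
    Complex.ofReal_im, Complex.inv_re, Complex.inv_im, Complex.conj_re, Complex.conj_im,
    ← hN] at hre him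
  set p := α * β with hp
  set s := α + β with hs
  have hp1 : p < 1 := by nlinarith
  have hp2 : -1 < p := by nlinarith
  have hs1 : s < 1 + p := by nlinarith
  have hs2 : -(1 + p) < s := by nlinarith
  -- rescaling the axes turns the ellipse into the unit circle; `(A, B)` is the image of `J(ω)`,
  -- reflected in the real axis
  set σ := s / (1 + p) with hσ
  set A := ω.re / N * ((1 + p * N) / (1 + p)) with hA
  set B := ω.im / N * ((1 - p * N) / (1 - p)) with hB
  have hpp : (1 + p) ≠ 0 := by linarith
  have hpm : (1 - p) ≠ 0 := by linarith
  have hmA : m * A = (m - 1) * σ + u.re := by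
    rw [hA, hσ]; field_simp; field_simp at hre; linear_combination hre
  have hmB : m * B = u.im := by
    rw [hB]; field_simp; field_simp at him; linear_combination -him
  have hσ1 : σ < 1 := by rw [hσ, div_lt_one (by linarith)]; exact hs1
  have hσ2 : -1 < σ := by rw [hσ, lt_div_iff₀ (by linarith)]; linarith
  have hσsq : σ ^ 2 ≤ 1 := by rw [sq_le_one_iff_abs_le_one, abs_le]; exact ⟨hσ2.le, hσ1.le⟩
  have hfac : 0 < (1 - N) * (1 - p ^ 2 * N) := by
    have hp3 : p ^ 2 < 1 := by rw [sq_lt_one_iff_abs_lt_one, abs_lt]; exact ⟨hp2, hp1⟩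
    have := mul_lt_one_of_nonneg_of_lt_one_right hp3.le hN0.le hN1
    exact mul_pos (by linarith) (by linarith)
  have hfac1 : N < ((1 + p * N) / (1 + p)) ^ 2 := by
    rw [div_pow, lt_div_iff₀ (by positivity)]
    linear_combination hfac
  have hfac2 : N < ((1 - p * N) / (1 - p)) ^ 2 := by
    rw [div_pow, lt_div_iff₀ (by positivity)]
    linear_combination hfac
  have hAB : 1 < A ^ 2 + B ^ 2 := by
    have hsum : (ω.re / N) ^ 2 + (ω.im / N) ^ 2 = 1 / N := by
      field_simp; linarith
    rw [hA, hB, mul_pow, mul_pow]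
    set a := (ω.re / N) ^ 2
    set b := (ω.im / N) ^ 2
    have ha0 : 0 ≤ a := sq_nonneg _
    have hb0 : 0 ≤ b := sq_nonneg _
    have hone : a * N + b * N = 1 := by rw [← add_mul, hsum]; field_simp
    have ha := mul_le_mul_of_nonneg_left hfac1.le ha0
    have hb := mul_le_mul_of_nonneg_left hfac2.le hb0
    rcases ha0.eq_or_lt with h0 | h0
    · have hb' : 0 < b := by
        rw [← h0, zero_mul, zero_add] at hone
        exact pos_of_mul_pos_left (hone ▸ one_pos) hN0.le
      linarith [mul_lt_mul_of_pos_left hfac2 hb']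
    · linarith [mul_lt_mul_of_pos_left hfac1 h0]
  have hle : m ^ 2 * (A ^ 2 + B ^ 2) ≤ m ^ 2 := by
    have e : m ^ 2 * (A ^ 2 + B ^ 2) = (m * A) ^ 2 + (m * B) ^ 2 := by ring
    have hua : σ * u.re ≤ 1 := by linarith [sq_nonneg (σ - u.re), mul_self_nonneg u.im, hσsq]
    have hmm : 0 ≤ m - 1 := by linarith
    rw [e, hmA, hmB]
    linarith [mul_le_mul_of_nonneg_left hua hmm,
      mul_le_mul_of_nonneg_left hσsq (sq_nonneg (m - 1))]
  linarith [mul_lt_mul_of_pos_left hAB (by positivity : 0 < m ^ 2)]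

/-! ### Subordination to the Möbius map `z ↦ (1 - αz) / (1 - βz)` -/

/-- The subordination step. The map `z ↦ (1 - αz) / (1 - βz)` carries the unit disc onto
`{w | ‖w - 1‖ < ‖βw - α‖}`, with inverse `w ↦ (w - 1) / (βw - α)`. If
`z w' / w = (β - α) ω / ((1 - αω)(1 - βω))` with `ω` a self-map of the disc and `w 0 = 1`, then
`w` takes values in this set. -/
theorem norm_sub_one_lt_of_logDeriv_eq {α β : ℝ} {w w' ω : ℂ → ℂ} (hα : |α| < 1) (hβ : |β| < 1)
    (hαβ : α < β) (hw0 : w 0 = 1) (hw : ∀ z ∈ disc, HasDerivAt w (w' z) z)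
    (hω : Set.MapsTo ω disc disc)
    (hode : ∀ z ∈ disc, z * w' z * ((1 - α * ω z) * (1 - β * ω z)) = (β - α) * ω z * w z) :
    ∀ z ∈ disc, ‖w z - 1‖ < ‖β * w z - α‖ := by
  by_contra! hcon
  obtain ⟨z₁, hz₁, hle₁⟩ := hcon
  have hz₁' : ‖z₁‖ < 1 := by simpa [disc] using hz₁
  have hcd : Metric.closedBall (0 : ℂ) ‖z₁‖ ⊆ disc := fun z hz => by
    simp only [disc, mem_ball_zero_iff]
    exact (mem_closedBall_zero_iff.mp hz).trans_lt hz₁'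
  have hwc : ContinuousOn w disc := fun z hz => (hw z hz).continuousAt.continuousWithinAt
  have hc1 : ContinuousOn (fun z => ‖w z - 1‖) disc := by fun_prop
  have hc2 : ContinuousOn (fun z => ‖β * w z - α‖) disc := by fun_prop
  -- compactness yields a point of least modulus at which the inequality fails
  have hK : IsCompact (Metric.closedBall (0 : ℂ) ‖z₁‖ ∩
      (fun z => ‖β * w z - α‖ - ‖w z - 1‖) ⁻¹' Set.Iic 0) :=
    (isCompact_closedBall 0 ‖z₁‖).of_isClosed_subset
      (((hc2.sub hc1).mono hcd).preimage_isClosed_of_isClosed Metric.isClosed_closedBall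
        isClosed_Iic) Set.inter_subset_left
  obtain ⟨z₀, ⟨hz₀K, hz₀le⟩, hmin⟩ := hK.exists_isMinOn
    ⟨z₁, by simp, by simpa using hle₁⟩ continuous_norm.continuousOn
  have hz₀ := hcd hz₀K
  have hβα : (β - α : ℂ) ≠ 0 := by exact_mod_cast (sub_pos.mpr hαβ).ne'
  have hz₀0 : z₀ ≠ 0 := by
    rintro rfl
    have : ‖(β : ℂ) - α‖ ≤ 0 := by simpa [hw0] using hz₀le
    exact hβα (norm_le_zero_iff.mp this)
  have hlt : ∀ z ∈ Metric.ball (0 : ℂ) ‖z₀‖, ‖w z - 1‖ < ‖β * w z - α‖ := by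
    intro z hz
    rw [mem_ball_zero_iff] at hz
    by_contra! hge
    have : ‖z₀‖ ≤ ‖z‖ := hmin
      ⟨mem_closedBall_zero_iff.mpr (hz.le.trans (mem_closedBall_zero_iff.mp hz₀K)),
        by simpa using hge⟩
    linarith
  have hsub : Metric.ball (0 : ℂ) ‖z₀‖ ⊆ disc :=
    Metric.ball_subset_ball (by simpa [disc] using hz₀ : ‖z₀‖ < 1).le
  have hclos : closure (Metric.ball (0 : ℂ) ‖z₀‖) = Metric.closedBall 0 ‖z₀‖ :=
    closure_ball 0 (norm_ne_zero_iff.mpr hz₀0)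
  have hclsub : closure (Metric.ball (0 : ℂ) ‖z₀‖) ⊆ disc := by
    rw [hclos]
    exact (Metric.closedBall_subset_closedBall (mem_closedBall_zero_iff.mp hz₀K)).trans hcd
  have heq : ‖w z₀ - 1‖ = ‖β * w z₀ - α‖ :=
    le_antisymm (le_on_closure (fun z hz => (hlt z hz).le) (hc1.mono hclsub) (hc2.mono hclsub)
      (by rw [hclos]; simp)) (by simpa using hz₀le)
  have hden : ∀ z, ‖w z - 1‖ ≤ ‖β * w z - α‖ → β * w z - α ≠ 0 := by
    intro z hle h0
    rw [h0, norm_zero, norm_le_zero_iff, sub_eq_zero] at hle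
    rw [hle, mul_one] at h0
    exact hβα h0
  set v : ℂ → ℂ := fun z => (w z - 1) / (β * w z - α) with hv
  have hvd : ∀ z ∈ disc, ‖w z - 1‖ ≤ ‖β * w z - α‖ →
      HasDerivAt v ((w' z * (β * w z - α) - (w z - 1) * (β * w' z)) / (β * w z - α) ^ 2) z :=
    fun z hz hle => ((hw z hz).sub_const 1).div (((hw z hz).const_mul (β : ℂ)).sub_const (α : ℂ))
      (hden z hle)
  have hD := hden z₀ heq.le
  have hvnorm : ‖v z₀‖ = 1 := by
    rw [hv]
    simp only [norm_div, heq]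
    exact div_self (norm_ne_zero_iff.mpr hD)
  obtain ⟨m, hm, hmv⟩ := jack_lemma hz₀0
    (fun z hz => (hvd z (hsub hz) (hlt z hz).le).differentiableAt.differentiableWithinAt)
    (by simp [hv, hw0])
    (fun z hz => by
      rw [hv]
      simp only [norm_div]
      exact div_le_one_of_le₀ (hlt z hz).le (norm_nonneg _))
    (hvd z₀ hz₀ heq.le) hvnorm
  refine joukowski_ellipse_ne hα hβ hm hvnorm (by simpa [disc] using hω hz₀ : ‖ω z₀‖ < 1) ?_
  rw [← hmv]
  have h := hode z₀ hz₀
  simp only [hv]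
  generalize w z₀ = W at *
  generalize ω z₀ = O at *
  generalize w' z₀ = W' at *
  have e1 : 1 - (α : ℂ) * ((W - 1) / (β * W - α)) = (β - α) * W / (β * W - α) := by
    rw [eq_div_iff hD, sub_mul, one_mul, mul_assoc, div_mul_cancel₀ _ hD]; ring
  have e2 : 1 - (β : ℂ) * ((W - 1) / (β * W - α)) = (β - α) / (β * W - α) := by
    rw [eq_div_iff hD, sub_mul, one_mul, mul_assoc, div_mul_cancel₀ _ hD]; ring
  rw [e1, e2]
  field_simp
  linear_combination (β - α : ℂ) * h

/-- The Schwarz lemma applied to `(w - 1) / (βw - α)`. -/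
theorem norm_sub_one_le_of_lt {α β : ℝ} {w : ℂ → ℂ} (hw0 : w 0 = 1)
    (hw : DifferentiableOn ℂ w disc) (h : ∀ z ∈ disc, ‖w z - 1‖ < ‖β * w z - α‖) :
    ∀ z ∈ disc, ‖w z - 1‖ ≤ ‖z‖ * ‖β * w z - α‖ := by
  intro z hz
  have hpos : ∀ z ∈ disc, 0 < ‖β * w z - α‖ := fun z hz => (norm_nonneg _).trans_lt (h z hz)
  have hd : DifferentiableOn ℂ (fun z => (w z - 1) / (β * w z - α)) disc :=
    (hw.sub_const 1).div ((hw.const_mul (β : ℂ)).sub_const (α : ℂ))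
      fun z hz => norm_pos_iff.mp (hpos z hz)
  have hs := Complex.norm_le_norm_of_mapsTo_ball hd
    (fun z hz => by
      rw [mem_closedBall_zero_iff, norm_div]
      exact div_le_one_of_le₀ (h z hz).le (norm_nonneg _))
    (by simp [hw0]) (by simpa [disc] using hz)
  rwa [norm_div, div_le_iff₀ (hpos z hz)] at hs

/-! ### The parameter bound -/

theorem beta1_le {α : ℝ} (h0 : 0 < α) (h1 : α < 1) : beta1 α ≤ (1 - α) / (1 + 3 * α) := by
  rw [beta1, div_le_div_iff₀ (by nlinarith) (by linarith)]
  -- the difference of the squares is `16 α² (1 - α²)²`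
  have hrt : (1 + α) * (1 + 3 * α) * Real.sqrt (α ^ 2 + 14 * α + 1)
      ≤ 5 * α ^ 3 + 15 * α ^ 2 + 11 * α + 1 := by
    refine abs_le_of_sq_le_sq' ?_ (by positivity) |>.2
    rw [mul_pow, Real.sq_sqrt (by positivity)]
    nlinarith [sq_nonneg (α * (1 - α ^ 2))]
  linarith

/-- The condition `𝒯₀(α, β) ≤ γ` implies `1 - γ ≤ 1 - αβ`, which is what keeps the argument of
`f(z)/z` below `π` in modulus. In the region `B₁` it comes from the Cauchy-Schwarz inequality;
elsewhere it reduces to `α + β + 3αβ ≤ 1`, which for `0 < α` is the bound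
`β ≤ (1 - α) / (1 + 3α)`. -/
theorem two_sub_le_of_snailT0_le {α β γ : ℝ} (hα : -1 < α) (hαβ : α < β) (hβ : β < 1)
    (hγ : snailT0 α β ≤ γ) : 2 - 2 * γ ≤ 2 * (1 - α * β) := by
  rw [snailT0] at hγ
  split_ifs at hγ with hB
  · obtain ⟨h0, -, -, -⟩ := hB
    simp only at h0
    have hp0 : 0 < α * β := mul_pos h0 (h0.trans hαβ)
    have hp1 : α * β < 1 := by nlinarith
    set p := α * β with hp
    set q := p * (1 - α ^ 2) * (1 - β ^ 2) with hq
    have hq0 : 0 ≤ q := by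
      have : 0 ≤ 1 - α ^ 2 := by nlinarith
      have : 0 ≤ 1 - β ^ 2 := by nlinarith
      positivity
    -- Cauchy-Schwarz for `(2 √p, 1 - p)` and `(√((1-α²)(1-β²)), α + β)`
    have hCS : 2 * Real.sqrt q + (α + β) * (1 - p) ≤ (1 + p) ^ 2 := by
      have hsb : (α + β) * (1 - p) ≤ (1 + p) ^ 2 := by
        nlinarith [mul_pos (by linarith : 0 < 1 - α) (by linarith : 0 < 1 - β)]
      have : 2 * Real.sqrt q ≤ (1 + p) ^ 2 - (α + β) * (1 - p) := by
        refine abs_le_of_sq_le_sq' ?_ (by linarith) |>.2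
        rw [mul_pow, Real.sq_sqrt hq0, hq]
        have : (1 - α ^ 2) * (1 - β ^ 2) = (1 + p) ^ 2 - (α + β) ^ 2 := by rw [hp]; ring
        rw [mul_assoc p, this]
        nlinarith [sq_nonneg ((1 + p) * ((α + β) - (1 - p)))]
      linarith
    have hdiv : (1 - p) * (2 * Real.sqrt q + (α + β) * (1 - p)) / (1 + p) ^ 2 ≤ 1 - p := by
      rw [div_le_iff₀ (by positivity)]
      exact mul_le_mul_of_nonneg_left hCS (by linarith)
    linarith
  · have hlin : α + β + 3 * (α * β) ≤ 1 := by
      rcases le_or_gt α 0 with h0 | h0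
      · rcases le_or_gt β 0 with hb | hb <;> nlinarith
      · have hβ1 : β ≤ beta1 α := by
          by_contra hlt
          exact hB ⟨h0, by simp only; linarith, not_le.mp hlt, hβ⟩
        have := hβ1.trans (beta1_le h0 (hαβ.trans hβ))
        rw [le_div_iff₀ (by linarith)] at this
        linarith
    nlinarith

/-! ### Geometry of the image disc -/

/-- The inequality `‖w - 1‖ ≤ r ‖βw - α‖`, squared and expanded. -/
theorem norm_sub_one_quadratic {α β r : ℝ} {w : ℂ}
    (h : ‖w - 1‖ ≤ r * ‖β * w - α‖) :
    ‖w‖ ^ 2 * (1 - r ^ 2 * β ^ 2) + (1 - r ^ 2 * α ^ 2) ≤ 2 * (1 - r ^ 2 * α * β) * w.re := by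
  have h2 : ‖w - 1‖ ^ 2 ≤ (r * ‖β * w - α‖) ^ 2 := by gcongr
  rw [mul_pow] at h2
  simp only [← Complex.normSq_eq_norm_sq, Complex.normSq_apply, Complex.sub_re, Complex.sub_im,
    Complex.mul_re, Complex.mul_im, Complex.ofReal_re, Complex.ofReal_im, Complex.one_re,
    Complex.one_im] at h2 ⊢
  linarith

/-- The set `‖w - 1‖ < ‖βw - α‖` is a disc centred on the real axis, with leftmost boundary point
`(1 + α) / (1 + β)`. -/
theorem lt_re_of_norm_sub_one_lt {α β : ℝ} {w : ℂ} (hα : -1 < α) (hαβ : α < β) (hβ : β < 1)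
    (h : ‖w - 1‖ < ‖β * w - α‖) : (1 + α) / (1 + β) < w.re := by
  have h2 : ‖w - 1‖ ^ 2 < ‖β * w - α‖ ^ 2 := by gcongr
  simp only [← Complex.normSq_eq_norm_sq, Complex.normSq_apply, Complex.sub_re, Complex.sub_im,
    Complex.mul_re, Complex.mul_im, Complex.ofReal_re, Complex.ofReal_im, Complex.one_re,
    Complex.one_im] at h2
  have hβ1 : 0 < 1 + β := by linarith
  rw [div_lt_iff₀ hβ1]
  by_contra! hle
  have hw1 : w.re ≤ 1 := by
    by_contra! hgt
    nlinarith
  have hfac : 0 ≤ ((1 + α) - w.re * (1 + β)) * ((1 - α) - w.re * (1 - β)) := by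
    refine mul_nonneg (by linarith) ?_
    nlinarith
  nlinarith [mul_nonneg (mul_self_nonneg w.im) (by nlinarith : 0 ≤ 1 - β * β)]

theorem one_sub_sq_mul_pos {α β r : ℝ} (hα : |α| < 1) (hβ : |β| < 1) (hr0 : 0 ≤ r) (hr : r < 1) :
    0 < 1 - r ^ 2 * α * β := by
  have h1 : r ^ 2 < 1 := by nlinarith
  have h2 : |α * β| < 1 := by
    rw [abs_mul]; exact mul_lt_one_of_nonneg_of_lt_one_left (abs_nonneg _) hα hβ.le
  have h3 : r ^ 2 * |α * β| < 1 := mul_lt_one_of_nonneg_of_lt_one_left (sq_nonneg r) h1 h2.le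
  have h4 : r ^ 2 * (α * β) ≤ r ^ 2 * |α * β| :=
    mul_le_mul_of_nonneg_left (le_abs_self _) (sq_nonneg r)
  linarith

/-- The set `‖w - 1‖ ≤ r ‖βw - α‖` is a closed disc seen from the origin under the angle
`2 arcsin (r (β - α) / (1 - r² αβ))`. -/
theorem abs_arg_le_arcsin {α β r : ℝ} {w : ℂ} (hα : |α| < 1) (hβ : |β| < 1) (hαβ : α ≤ β)
    (hr0 : 0 ≤ r) (hr : r < 1) (hw : 0 < w.re) (h : ‖w - 1‖ ≤ r * ‖β * w - α‖) :
    |w.arg| ≤ Real.arcsin (r * (β - α) / (1 - r ^ 2 * α * β)) := by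
  have hC := one_sub_sq_mul_pos hα hβ hr0 hr
  have hA := one_sub_sq_mul_pos hβ hβ hr0 hr
  have hB := one_sub_sq_mul_pos hα hα hr0 hr
  have hq := norm_sub_one_quadratic h
  set C := 1 - r ^ 2 * α * β with hCdef
  set A := 1 - r ^ 2 * β * β with hAdef
  set B := 1 - r ^ 2 * α * α with hBdef
  have hn : 0 < ‖w‖ := norm_pos_iff.mpr fun h0 => by simp [h0] at hw
  have hnsq : ‖w‖ ^ 2 = w.re ^ 2 + w.im ^ 2 := by
    rw [← Complex.normSq_eq_norm_sq, Complex.normSq_apply]; ring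
  have hq' : ‖w‖ ^ 2 * A + B ≤ 2 * C * w.re := by rw [hAdef, hBdef]; linarith
  -- the arithmetic-geometric mean inequality turns the quadratic inequality into a bound on
  -- the cosine `w.re / ‖w‖`
  have hcos : A * B * ‖w‖ ^ 2 ≤ C ^ 2 * w.re ^ 2 := by
    have h0 : 0 ≤ ‖w‖ ^ 2 * A + B := by positivity
    have h1 : (‖w‖ ^ 2 * A + B) ^ 2 ≤ (2 * C * w.re) ^ 2 := by gcongr
    linarith [sq_nonneg (‖w‖ ^ 2 * A - B)]
  have hABC : C ^ 2 - A * B = (r * (β - α)) ^ 2 := by rw [hCdef, hAdef, hBdef]; ring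
  have hsin : |w.im / ‖w‖| ≤ r * (β - α) / C := by
    have hx : 0 ≤ r * (β - α) := mul_nonneg hr0 (by linarith)
    rw [abs_div, abs_of_pos hn, div_le_div_iff₀ hn hC]
    refine abs_le_of_sq_le_sq' ?_ (by positivity) |>.2
    rw [mul_pow, mul_pow, sq_abs, ← hABC]
    have : w.im ^ 2 = ‖w‖ ^ 2 - w.re ^ 2 := by linarith
    rw [this]
    linarith
  rw [Complex.arg_of_re_nonneg hw.le, abs_le, ← Real.arcsin_neg]
  exact ⟨Real.arcsin_le_arcsin (abs_le.mp hsin).1, Real.arcsin_le_arcsin (abs_le.mp hsin).2⟩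

/-- Jordan's inequality `arcsin x ≤ πx/2` turns `c ≤ 2 (1 - αβ)` into the bound `π` for the
argument. -/
theorem mul_arcsin_lt_pi {α β r c : ℝ} (hα : -1 < α) (hαβ : α < β) (hβ : β < 1)
    (hc : 0 < c) (hcle : c ≤ 2 * (1 - α * β)) (hr0 : 0 ≤ r) (hr : r < 1) :
    c / (β - α) * Real.arcsin (r * (β - α) / (1 - r ^ 2 * α * β)) < Real.pi := by
  have hα' : |α| < 1 := abs_lt.mpr ⟨hα, by linarith⟩
  have hβ' : |β| < 1 := abs_lt.mpr ⟨by linarith, hβ⟩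
  have hC := one_sub_sq_mul_pos hα' hβ' hr0 hr
  have hC1 : 0 < 1 - α * β := by linarith
  have hd : 0 < β - α := by linarith
  set x := r * (β - α) / (1 - r ^ 2 * α * β) with hx
  have hx0 : 0 ≤ x := by positivity
  have hlt : x < (β - α) / (1 - α * β) := by
    rw [hx, div_lt_div_iff₀ hC hC1]
    -- `r ↦ r / (1 - r² αβ)` increases on `[0, 1]`, by this factorization
    have : 0 < (β - α) * ((1 - r) * (1 + r * (α * β))) := by
      refine mul_pos hd (mul_pos (by linarith) ?_)
      have := one_sub_sq_mul_pos (α := -α) (β := β) (r := Real.sqrt r) (by rwa [abs_neg]) hβ'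
        (Real.sqrt_nonneg r) (by rw [Real.sqrt_lt' one_pos]; simpa using hr)
      rw [Real.sq_sqrt hr0] at this
      linarith
    linarith
  have hx1 : x ≤ 1 := by
    refine hlt.le.trans ?_
    rw [div_le_one hC1]
    nlinarith
  have hjordan : 2 / Real.pi * Real.arcsin x ≤ x := by
    simpa [Real.sin_arcsin (by linarith) hx1] using
      Real.mul_le_sin (Real.arcsin_nonneg.mpr hx0) (Real.arcsin_le_pi_div_two x)
  have hpi := Real.pi_pos
  have harc : Real.arcsin x ≤ Real.pi / 2 * x := by
    calc Real.arcsin x = Real.pi / 2 * (2 / Real.pi * Real.arcsin x) := by field_simp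
      _ ≤ _ := by gcongr
  calc c / (β - α) * Real.arcsin x ≤ c / (β - α) * (Real.pi / 2 * x) := by gcongr
    _ < c / (β - α) * (Real.pi / 2 * ((β - α) / (1 - α * β))) := by gcongr
    _ = Real.pi * (c / (2 * (1 - α * β))) := by field_simp
    _ ≤ Real.pi * 1 := by gcongr; rw [div_le_one (by linarith)]; exact hcle
    _ = Real.pi := mul_one _

/-- For `0 ≤ k ≤ 1` the principal power satisfies `(Re w) ^ k ≤ Re (w ^ k)` in the right
half-plane: concavity of the cosine and the weighted arithmetic-geometric mean inequality give
`(cos θ) ^ k ≤ k cos θ + (1 - k) ≤ cos (kθ)`. -/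
theorem re_rpow_le_re_exp_mul_log {k : ℝ} {w : ℂ} (hk0 : 0 ≤ k) (hk1 : k ≤ 1) (hw : 0 < w.re) :
    w.re ^ k ≤ (Complex.exp (k * Complex.log w)).re := by
  have hw0 : w ≠ 0 := fun h0 => by simp [h0] at hw
  have hn : 0 < ‖w‖ := norm_pos_iff.mpr hw0
  have harg : |w.arg| < Real.pi / 2 := Complex.abs_arg_lt_pi_div_two_iff.mpr (Or.inl hw)
  have hcos0 : 0 ≤ Real.cos w.arg := Real.cos_nonneg_of_mem_Icc
    ⟨(abs_lt.mp harg).1.le, (abs_lt.mp harg).2.le⟩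
  have hconc : k • Real.cos w.arg + (1 - k) • Real.cos 0 ≤ Real.cos (k • w.arg + (1 - k) • 0) :=
    strictConcaveOn_cos_Icc.concaveOn.2 ⟨(abs_lt.mp harg).1.le, (abs_lt.mp harg).2.le⟩
      ⟨by linarith [Real.pi_pos], by linarith [Real.pi_pos]⟩ hk0 (by linarith) (by ring)
  have hamgm := Real.geom_mean_le_arith_mean2_weighted hk0 (by linarith : 0 ≤ 1 - k) hcos0
    zero_le_one (by ring)
  have hcos : Real.cos w.arg ^ k ≤ Real.cos (k * w.arg) := by
    simp at hconc hamgm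
    linarith
  have hre : w.re = ‖w‖ * Real.cos w.arg := by
    rw [Complex.cos_arg hw0]; field_simp
  rw [Complex.exp_re]
  have h1 : ((k : ℂ) * Complex.log w).re = Real.log ‖w‖ * k := by
    simp [Complex.log_re, mul_comm]
  have h2 : ((k : ℂ) * Complex.log w).im = k * w.arg := by simp [Complex.log_im]
  rw [h1, h2, ← Real.rpow_def_of_pos hn, hre, Real.mul_rpow hn.le hcos0]
  gcongr

/-! ### Holomorphic logarithms on the disc -/

/-- A holomorphic logarithm of a zero-free function on the unit disc. -/
theorem exists_log_disc {F : ℂ → ℂ} (hF : DifferentiableOn ℂ F disc) (h0 : ∀ z ∈ disc, F z ≠ 0)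
    (hF0 : F 0 = 1) : ∃ g : ℂ → ℂ, g 0 = 0 ∧
      (∀ z ∈ disc, HasDerivAt g (deriv F z / F z) z) ∧ ∀ z ∈ disc, F z = Complex.exp (g z) := by
  have hopen : IsOpen disc := Metric.isOpen_ball
  have hlog : DifferentiableOn ℂ (fun z => deriv F z / F z) (Metric.ball 0 1) :=
    (hF.deriv hopen).div hF h0
  obtain ⟨g, hg0, hg⟩ := hlog.isExactOn_ball.with_val_at 0 0
  refine ⟨g, hg0, hg, fun z hz => ?_⟩
  have hd : ∀ z ∈ disc, HasDerivAt (fun z => F z * Complex.exp (-g z)) 0 z := by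
    intro z hz
    have hFz := (hF.differentiableAt (hopen.mem_nhds hz)).hasDerivAt
    refine (hFz.mul (hg z hz).neg.cexp).congr_deriv ?_
    have := h0 z hz
    field_simp
    ring
  have hconst := hopen.is_const_of_deriv_eq_zero (convex_ball (0 : ℂ) 1).isPreconnected
    (fun z hz => (hd z hz).differentiableAt.differentiableWithinAt)
    (fun z hz => (hd z hz).deriv) hz (by simp [disc] : (0 : ℂ) ∈ disc)
  simp only [hF0, hg0, neg_zero, Complex.exp_zero, mul_one, Complex.exp_neg] at hconst
  exact (mul_inv_eq_one₀ (Complex.exp_ne_zero _)).mp hconst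

/-- If `exp ∘ h` avoids the branch cut on the disc and `h 0 = 0`, then `h` is the principal branch
of its logarithm. -/
theorem log_exp_of_slitPlane_disc {h : ℂ → ℂ} (hd : DifferentiableOn ℂ h disc) (h0 : h 0 = 0)
    (hs : ∀ z ∈ disc, Complex.exp (h z) ∈ Complex.slitPlane) :
    ∀ z ∈ disc, Complex.log (Complex.exp (h z)) = h z := by
  have hopen : IsOpen disc := Metric.isOpen_ball
  have hlog : ∀ z ∈ disc, HasDerivAt (fun z => Complex.log (Complex.exp (h z))) (deriv h z) z := by
    intro z hz
    have hz' := (hd.differentiableAt (hopen.mem_nhds hz)).hasDerivAt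
    refine (hz'.cexp.clog (hs z hz)).congr_deriv ?_
    field_simp [Complex.exp_ne_zero]
  exact hopen.eqOn_of_deriv_eq (convex_ball (0 : ℂ) 1).isPreconnected
    (fun z hz => (hlog z hz).differentiableAt.differentiableWithinAt) hd
    (fun z hz => (hlog z hz).deriv) (by simp [disc] : (0 : ℂ) ∈ disc) (by simp [h0])

/-! ### The quotient `f(z)/z` -/

theorem differentiableOn_divZ {f : ℂ → ℂ} (hf : f ∈ classS) : DifferentiableOn ℂ (divZ f) disc := by
  obtain ⟨hfd, -, hf0, hf1⟩ := hf
  have : divZ f = dslope f 0 := by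
    funext z
    rcases eq_or_ne z 0 with rfl | hz
    · simp [divZ, hf1]
    · rw [dslope_of_ne _ hz, slope_def_field, hf0, sub_zero, sub_zero, divZ, if_neg hz]
  rw [this]
  exact (Complex.differentiableOn_dslope (Metric.ball_mem_nhds 0 one_pos)).mpr hfd

theorem divZ_ne_zero {f : ℂ → ℂ} (hf : f ∈ classS) : ∀ z ∈ disc, divZ f z ≠ 0 := by
  obtain ⟨-, hinj, hf0, -⟩ := hf
  intro z hz
  rcases eq_or_ne z 0 with rfl | hz0
  · simp [divZ]
  · rw [divZ, if_neg hz0]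
    exact div_ne_zero (fun h => hz0 (hinj hz (by simp [disc]) (h.trans hf0.symm))) hz0

/-- With `F(z) = f(z)/z`, the logarithmic derivative satisfies `z F'/F = z f'/f - 1`. -/
theorem mul_deriv_divZ_div {f : ℂ → ℂ} (hf : f ∈ classS) : ∀ z ∈ disc,
    z * (deriv (divZ f) z / divZ f z) = logDerivZ f z - 1 := by
  intro z hz
  have hF0 := divZ_ne_zero hf z hz
  rcases eq_or_ne z 0 with rfl | hz0
  · simp [logDerivZ]
  · have hfz := (hf.1.differentiableAt (Metric.isOpen_ball.mem_nhds hz)).hasDerivAt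
    have hev : divZ f =ᶠ[𝓝 z] fun y => f y / y := by
      filter_upwards [isOpen_ne.mem_nhds hz0] with y hy
      exact if_neg hy
    have hdiv : HasDerivAt (fun y => f y / y) ((deriv f z * z - f z * 1) / z ^ 2) z :=
      hfz.div (hasDerivAt_id z) hz0
    rw [hev.deriv_eq, hdiv.deriv]
    rw [divZ, if_neg hz0] at hF0 ⊢
    have hfz0 : f z ≠ 0 := fun h => hF0 (by simp [h])
    rw [logDerivZ, if_neg hz0]
    field_simp

theorem ne_zero_of_abs_lt {a : ℝ} {ζ : ℂ} (ha : |a| < 1) (hζ : ‖ζ‖ < 1) : 1 - (a : ℂ) * ζ ≠ 0 := by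
  intro h
  have h1 : ‖(a : ℂ) * ζ‖ = 1 := by rw [← sub_eq_zero.mp h, norm_one]
  rw [norm_mul, Complex.norm_real, Real.norm_eq_abs] at h1
  exact absurd h1 (mul_lt_one_of_nonneg_of_lt_one_left (abs_nonneg a) ha hζ.le).ne

end PascalSnail

theorem mainTheorem2 (α β γ : ℝ) (hα : -1 < α) (hαβ : α < β) (hβ : β < 1)
    (hγ0 : 0 ≤ γ) (hγ1 : γ < 1) (hγ : PascalSnail.snailT0 α β ≤ γ)
    (f : ℂ → ℂ) (hf : f ∈ PascalSnail.STsnail α β γ) :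
    -- the principal power and the principal argument of `f(z)/z` are continuous in the disc
    (∀ z ∈ PascalSnail.disc, PascalSnail.divZ f z ∈ Complex.slitPlane) ∧
    (PascalSnail.snailT0 α β ≤ 1 - (β - α) / 2 → 1 - (β - α) / 2 ≤ γ →
      ∀ z ∈ PascalSnail.disc,
        ((1 + α) / (1 + β)) ^ ((2 - 2 * γ) / (β - α)) < (PascalSnail.divZ f z).re) ∧
    (∀ z ∈ PascalSnail.disc,
      (1 + α) / (1 + β) <
        (PascalSnail.divZ f z ^ (((β - α) / (2 - 2 * γ) : ℝ) : ℂ)).re) ∧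
    (∀ z ∈ PascalSnail.disc,
      |Complex.arg (PascalSnail.divZ f z)| ≤
        2 * (1 - γ) / (β - α) * Real.arcsin (‖z‖ * (β - α) / (1 - ‖z‖ ^ 2 * α * β))) := by
  open PascalSnail in
  obtain ⟨hfS, -, -, ω, -, hωm, -, hsub⟩ := hf
  have hα' : |α| < 1 := abs_lt.mpr ⟨hα, by linarith⟩
  have hβ' : |β| < 1 := abs_lt.mpr ⟨by linarith, hβ⟩
  have hd : 0 < β - α := by linarith
  have hc : 0 < 2 - 2 * γ := by linarith
  have hnorm : ∀ z ∈ disc, ‖z‖ < 1 := fun z hz => by simpa [disc] using hz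
  set k := (2 - 2 * γ) / (β - α) with hk
  have hk0 : 0 < k := div_pos hc hd
  have hkC : (k : ℂ) ≠ 0 := by exact_mod_cast hk0.ne'
  obtain ⟨g, hg0, hg, hFg⟩ := exists_log_disc (differentiableOn_divZ hfS) (divZ_ne_zero hfS)
    (by simp [divZ])
  -- `w` is the branch of `(f(z)/z) ^ (1/k)` determined by `g`
  set w : ℂ → ℂ := fun z => Complex.exp (g z / k) with hw
  have hwd : ∀ z ∈ disc,
      HasDerivAt w (Complex.exp (g z / k) * (deriv (divZ f) z / divZ f z / k)) z :=
    fun z hz => ((hg z hz).div_const (k : ℂ)).cexp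
  have hw0 : w 0 = 1 := by simp [hw, hg0]
  have hlt : ∀ z ∈ disc, ‖w z - 1‖ < ‖β * w z - α‖ := by
    refine norm_sub_one_lt_of_logDeriv_eq hα' hβ' hαβ hw0 hwd hωm fun z hz => ?_
    have h1 : 1 - (α : ℂ) * ω z ≠ 0 := ne_zero_of_abs_lt hα' (hnorm _ (hωm hz))
    have h2 : 1 - (β : ℂ) * ω z ≠ 0 := ne_zero_of_abs_lt hβ' (hnorm _ (hωm hz))
    have hq := mul_deriv_divZ_div hfS z hz
    rw [hsub z hz, snailT, snailL, add_sub_cancel_left, eq_div_iff (mul_ne_zero h1 h2)] at hq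
    have hkd : (k : ℂ) * (β - α) = 2 - 2 * γ := by
      have : k * (β - α) = 2 - 2 * γ := div_mul_cancel₀ _ hd.ne'
      exact_mod_cast this
    rw [← hkd] at hq
    refine mul_left_cancel₀ hkC ?_
    calc _ = z * (deriv (divZ f) z / divZ f z) * ((1 - α * ω z) * (1 - β * ω z)) * w z := by
          simp only [hw]; field_simp
      _ = _ := by rw [hq]; ring
  have hle := norm_sub_one_le_of_lt hw0
    (fun z hz => (hwd z hz).differentiableAt.differentiableWithinAt) hlt
  have hre : ∀ z ∈ disc, (1 + α) / (1 + β) < (w z).re := fun z hz =>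
    lt_re_of_norm_sub_one_lt hα hαβ hβ (hlt z hz)
  have hm0 : 0 < (1 + α) / (1 + β) := div_pos (by linarith) (by linarith)
  have hlogw : ∀ z ∈ disc, Complex.log (w z) = g z / k :=
    log_exp_of_slitPlane_disc
      (fun z hz => ((hg z hz).div_const (k : ℂ)).differentiableAt.differentiableWithinAt)
      (by simp [hg0]) (fun z hz => Or.inl (hm0.trans (hre z hz)))
  have hgw : ∀ z ∈ disc, g z = k * Complex.log (w z) := fun z hz => by
    rw [hlogw z hz]; field_simp
  have him : ∀ z ∈ disc, |(g z).im| ≤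
      k * Real.arcsin (‖z‖ * (β - α) / (1 - ‖z‖ ^ 2 * α * β)) := by
    intro z hz
    have h := abs_arg_le_arcsin hα' hβ' hαβ.le (norm_nonneg z) (hnorm z hz)
      (hm0.trans (hre z hz)) (hle z hz)
    rw [hgw z hz, Complex.im_ofReal_mul, Complex.log_im, abs_mul, abs_of_pos hk0]
    gcongr
  have hpi : ∀ z ∈ disc, |(g z).im| < Real.pi := fun z hz => (him z hz).trans_lt
    (mul_arcsin_lt_pi hα hαβ hβ hc (two_sub_le_of_snailT0_le hα hαβ hβ hγ) (norm_nonneg z)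
      (hnorm z hz))
  have hlogF : ∀ z ∈ disc, Complex.log (divZ f z) = g z := fun z hz => by
    rw [hFg z hz, Complex.log_exp (abs_lt.mp (hpi z hz)).1 (abs_lt.mp (hpi z hz)).2.le]
  have harg : ∀ z ∈ disc, (divZ f z).arg = (g z).im := fun z hz => by
    rw [← hlogF z hz, Complex.log_im]
  refine ⟨fun z hz => ?_, fun _ hγ2 z hz => ?_, fun z hz => ?_, fun z hz => ?_⟩
  · rw [Complex.mem_slitPlane_iff_arg, harg z hz]
    exact ⟨(abs_lt.mp (hpi z hz)).2.ne, divZ_ne_zero hfS z hz⟩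
  · rw [hFg z hz, hgw z hz]
    refine lt_of_lt_of_le ?_ (re_rpow_le_re_exp_mul_log hk0.le
      ((div_le_one hd).mpr (by linarith)) (hm0.trans (hre z hz)))
    exact Real.rpow_lt_rpow hm0.le (hre z hz) hk0
  · have hinv : (β - α) / (2 - 2 * γ) = k⁻¹ := by rw [hk, inv_div]
    rw [Complex.cpow_def_of_ne_zero (divZ_ne_zero hfS z hz), hlogF z hz, hinv,
      Complex.ofReal_inv, ← div_eq_mul_inv]
    exact hre z hz
  · rw [harg z hz, mul_sub, mul_one]
    exact him z hz
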